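/- Let $\omega\colon[0,\infty)\to[0,\infty)$ be a concave modulus of continuity, i.e. a continuous, non-decreasing, concave function with $\omega(0)=0$, and set $I(t)=\int_0^t\omega(s)\,ds$ for $t\ge 0$. Let $(\Omega,\mathcal F,P)$ be a probability space, and let $\mathcal R$ be the set of random variables on $\Omega$ with values in $[0,1]$. Let $\mathcal H^\omega$ be the class of all measurable real random processes $\xi_t$, $t\in[0,1]$, on $\Omega$ such that $\mathbf E|\xi_\tau-\xi_\theta|\le\omega(\|\tau-\theta\|_\infty)$ for all $\tau,\theta\in\mathcal R$, where $\|\cdot\|_\infty$ is the essential supremum norm. For $\tau_1,\dots,\tau_n\in\mathcal R$ let $$E(\tau_1,\dots,\tau_n)=\inf_{\varphi}\ \sup_{\xi\in\mathcal H^\omega}\mathbf E\left|\int_0^1\xi_t\,dt-\varphi(\xi_{\tau_1},\dots,\xi_{\tau_n})\right|$$ be the optimal error of recovery of the integral, the infimum being over all maps $\varphi$ that send $n$-tuples of real random variables on $\Omega$ to real random variables on $\Omega$. Let $n\ge 1$, $\tau\in\mathcal R$, $m=\operatorname{ess\,inf}\tau$ and $M=\operatorname{ess\,sup}\tau$. Call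 $(t_1,\dots,t_n)$ admissible if $0=t_1<t_2<\dots<t_n$ and $\tau+t_n\le 1$ almost everywhere, and put $\tau_k=\tau+t_k$, $k=1,\dots,n$. Assume that an admissible tuple exists (that is, $n=1$ or $M<1$). All infima below are over admissible tuples. 1. If $(2n-1)m+M\ge 1$, then $$\inf_{t_2,\dots,t_n}E(\tau_1,\dots,\tau_n)=(2n-1)\,I\!\left(\frac{1-M}{2n-1}\right)+I(M),$$ and the infimum is attained at the admissible tuple $t_k=\frac{2(k-1)(1-M)}{2n-1}$, $k=1,\dots,n$. 2. If $(2n-1)M+m\le 1$, then $$\inf_{t_2,\dots,t_n}E(\tau_1,\dots,\tau_n)=(2n-1)\,I\!\left(\frac{1-m}{2n-1}\right)+I(m),$$ and the infimum is attained at the admissible tuple $t_k=\frac{2(k-1)(1-m)}{2n-1}$, $k=1,\dots,n$. 3. Otherwise (in which case $n\ge 2$), $$\inf_{t_2,\dots,t_n}E(\tau_1,\dots,\tau_n)=(2n-2)\,I\!\left(\frac{1-m-M}{2n-2}\right)+I(m)+I(M),$$ and the infimum is attained at the admissible tuple $t_k=\frac{(k-1)(1-m-M)}{n-1}$, $k=1,\dots,n$.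 -/

import Mathlib

open MeasureTheory

namespace OptimalRecovery

/-- A concave modulus of continuity: a continuous non-decreasing concave function
`ω : [0, ∞) → [0, ∞)` with `ω 0 = 0`. Only the values of `ω` on `[0, ∞)` matter; that these are
non-negative follows from monotonicity and `ω 0 = 0`. -/
structure IsConcaveModulus (ω : ℝ → ℝ) : Prop where
  continuousOn : ContinuousOn ω (Set.Ici 0)
  monotoneOn : MonotoneOn ω (Set.Ici 0)
  concaveOn : ConcaveOn ℝ (Set.Ici 0) ω
  map_zero : ω 0 = 0

/-- The real random variables on `Ω`. -/
abbrev RandomVariable (Ω : Type*) [MeasurableSpace Ω] : Type _ :=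
  {η : Ω → ℝ // Measurable η}

/-- The random variables on `Ω` all of whose values lie in `[0, 1]`. -/
abbrev RandomTime (Ω : Type*) [MeasurableSpace Ω] : Type _ :=
  {τ : Ω → unitInterval // Measurable τ}

/-- The (jointly) measurable real random processes `ξ t`, `t ∈ [0, 1]`, on `Ω`. -/
abbrev MeasurableProcess (Ω : Type*) [MeasurableSpace Ω] : Type _ :=
  {ξ : unitInterval → Ω → ℝ // Measurable (Function.uncurry ξ)}

/-- The random variable `ξ_τ : w ↦ ξ_{τ(w)}(w)`. -/
def sample {Ω : Type*} [MeasurableSpace Ω] (ξ : MeasurableProcess Ω) (τ : RandomTime Ω) :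
    RandomVariable Ω :=
  ⟨fun w => ξ.1 (τ.1 w) w, ξ.2.comp (τ.2.prodMk measurable_id)⟩

/-- The class of measurable processes `ξ` with `E|ξ_τ - ξ_θ| ≤ ω(‖τ - θ‖_∞)` for all random
variables `τ`, `θ` with values in `[0, 1]`. -/
def processClass {Ω : Type*} [MeasurableSpace Ω] (P : Measure Ω) (ω : ℝ → ℝ) :
    Set (MeasurableProcess Ω) :=
  {ξ | ∀ τ θ : RandomTime Ω,
    ∫⁻ w, ‖(sample ξ τ).1 w - (sample ξ θ).1 w‖ₑ ∂P ≤
      ENNReal.ofReal (ω (essSup (fun w => |(τ.1 w : ℝ) - (θ.1 w : ℝ)|) P))}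

/-- The error of recovery of the integral `∫₀¹ ξ_t dt` over the class, by the method that sends the
information `(ξ_{τ₁}, …, ξ_{τₙ})` to the random variable `φ(ξ_{τ₁}, …, ξ_{τₙ})`. For `ξ` in the
class the inner integral converges absolutely for almost every `w`. -/
noncomputable def methodError {Ω : Type*} [MeasurableSpace Ω] (P : Measure Ω) (ω : ℝ → ℝ) {n : ℕ}
    (τ : Fin n → RandomTime Ω) (φ : (Fin n → RandomVariable Ω) → RandomVariable Ω) : ENNReal :=
  ⨆ ξ ∈ processClass P ω,
    ∫⁻ w, ‖(∫ t : unitInterval, ξ.1 t w) - (φ fun k => sample ξ (τ k)).1 w‖ₑ ∂P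

/-- The optimal error of recovery `E(τ₁, …, τₙ)`: the infimum of the error over all methods. -/
noncomputable def optimalError {Ω : Type*} [MeasurableSpace Ω] (P : Measure Ω) (ω : ℝ → ℝ) {n : ℕ}
    (τ : Fin n → RandomTime Ω) : ENNReal :=
  ⨅ φ : (Fin n → RandomVariable Ω) → RandomVariable Ω, methodError P ω τ φ

/-- The random time `τ + s`, put back into `[0, 1]` where it leaves it (for the shifts considered
here, only on a null set). -/
noncomputable def shift {Ω : Type*} [MeasurableSpace Ω] (τ : RandomTime Ω) (s : ℝ) :
    RandomTime Ω :=
  ⟨fun w => Set.projIcc (0 : ℝ) 1 zero_le_one ((τ.1 w : ℝ) + s),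
    continuous_projIcc.measurable.comp ((measurable_subtype_coe.comp τ.2).add_const s)⟩

/-- The admissible delays `0 = t₁ < ⋯ < tₙ`, with `τ + tₖ ≤ 1` almost everywhere for all `k`
(equivalently, for `k = n`). The indices are shifted by one: `t k` stands for `t_{k+1}`. -/
def admissibleDelays {Ω : Type*} [MeasurableSpace Ω] (P : Measure Ω) (τ : RandomTime Ω)
    (n : ℕ) [NeZero n] : Set (Fin n → ℝ) :=
  {t | t 0 = 0 ∧ StrictMono t ∧ ∀ k, ∀ᵐ w ∂P, (τ.1 w : ℝ) + t k ≤ 1}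

/-- The function `I(t) = ∫₀ᵗ ω(s) ds`. -/
noncomputable def modulusIntegral (ω : ℝ → ℝ) (t : ℝ) : ℝ :=
  ∫ s in (0 : ℝ)..t, ω s

/-- The optimal error for the measurement times `τ + t₁, …, τ + tₙ`. -/
noncomputable def delayError {Ω : Type*} [MeasurableSpace Ω] (P : Measure Ω) (ω : ℝ → ℝ)
    (τ : RandomTime Ω) {n : ℕ} (t : Fin n → ℝ) : ENNReal :=
  optimalError P ω fun k => shift τ (t k)

/-- `v` is the infimum of the optimal error over all admissible delays, and it is attained at the
admissible delays `t`. -/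
def IsOptimum {Ω : Type*} [MeasurableSpace Ω] (P : Measure Ω) (ω : ℝ → ℝ)
    (τ : RandomTime Ω) (n : ℕ) [NeZero n] (v : ℝ) (t : Fin n → ℝ) : Prop :=
  (⨅ s ∈ admissibleDelays P τ n, delayError P ω τ s) = ENNReal.ofReal v ∧
    t ∈ admissibleDelays P τ n ∧ delayError P ω τ t = ENNReal.ofReal v

end OptimalRecovery

/-! Lower bound. Near any point s of the essential range of τ, take the process ω(distance to the
nearest node), supported on the event {|τ - s| ≤ ε} and divided by its probability. The class only
controls expectations, so this concentration is free (`bump_mem_processClass`). The process and its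
negative vanish at every node and carry the same information, so no method beats ∫₀¹ ω(dist(x, {s +
tₖ})) dx (`ofReal_integral_nodeDist_le_delayError`). This integral is at least a sum of values of
the convex function I at half-gaps and end lengths. Tangent lines to I make the bound depend on the
delays through tₙ only (`tangent_le_delayError`).

Upper bound. Let A ≤ τ ≤ B almost everywhere and let the N + 1 nodes τ + 2kh satisfy 2Nh + A + B =
1. The 2N inner half-cells cost I(h) each. The end pieces have random lengths τ and A + B - τ;
bounding them separately is too crude. Distances v ≤ A occur at both ends and cost 2I(A). The
remaining parts are laid along (A, τ] and (τ, B], so each v in (A, B] is used once, by a single pair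
of random times at distance at most v; this costs I(B) - I(A). The total is 2N I(h) + I(A) + I(B)
(`delayError_le`).

The three cases are the choices (A, B) = (h, M), (m, h), (m, M), and s = M or s = m gives the
matching lower bound. -/

namespace OptimalRecovery

/-! ### Concave moduli and the convex function I. -/

namespace IsConcaveModulus

variable {ω : ℝ → ℝ}

lemma nonneg (hω : IsConcaveModulus ω) {x : ℝ} (hx : 0 ≤ x) : 0 ≤ ω x := by
  have := hω.monotoneOn (Set.mem_Ici.2 le_rfl) (Set.mem_Ici.2 hx) hx
  rwa [hω.map_zero] at this

lemma mono (hω : IsConcaveModulus ω) {x y : ℝ} (hx : 0 ≤ x) (hxy : x ≤ y) : ω x ≤ ω y :=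
  hω.monotoneOn (Set.mem_Ici.2 hx) (Set.mem_Ici.2 (hx.trans hxy)) hxy

lemma mul_le (hω : IsConcaveModulus ω) {x c : ℝ} (hx : 0 ≤ x) (hc : 0 ≤ c) (hc' : c ≤ 1) :
    c * ω x ≤ ω (c * x) := by
  have := hω.concaveOn.2 (Set.mem_Ici.2 hx) (Set.mem_Ici.2 (le_refl (0 : ℝ))) hc
    (sub_nonneg.2 hc') (by ring)
  simpa [hω.map_zero] using this

lemma add_le (hω : IsConcaveModulus ω) {x y : ℝ} (hx : 0 ≤ x) (hy : 0 ≤ y) :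
    ω (x + y) ≤ ω x + ω y := by
  rcases hx.eq_or_lt with rfl | hx'
  · simp [hω.map_zero]
  have hxy : 0 < x + y := by linarith
  have h1 := hω.mul_le hxy.le (c := x / (x + y)) (by positivity) (by rw [div_le_one hxy]; linarith)
  have h2 := hω.mul_le hxy.le (c := y / (x + y)) (by positivity) (by rw [div_le_one hxy]; linarith)
  rw [div_mul_cancel₀ _ hxy.ne'] at h1 h2
  have : x / (x + y) * ω (x + y) + y / (x + y) * ω (x + y) = ω (x + y) := by
    field_simp
  linarith

lemma sub_le (hω : IsConcaveModulus ω) {x y d : ℝ} (hx : 0 ≤ x) (hy : 0 ≤ y)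
    (hd : |x - y| ≤ d) : |ω x - ω y| ≤ ω d := by
  obtain ⟨h1, h2⟩ := abs_le.1 hd
  have hd0 : 0 ≤ d := (abs_nonneg _).trans hd
  have h3 := (hω.mono hx (show x ≤ y + d by linarith)).trans (hω.add_le hy hd0)
  have h4 := (hω.mono hy (show y ≤ x + d by linarith)).trans (hω.add_le hx hd0)
  rw [abs_le]; constructor <;> linarith

/-- Extending ω by 0 to the left turns continuity on the half-line into global continuity and
measurability of compositions with non-negative functions. -/
lemma continuous_max (hω : IsConcaveModulus ω) : Continuous fun x => ω (max x 0) :=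
  hω.continuousOn.comp_continuous (by fun_prop) fun x => Set.mem_Ici.2 (le_max_right x 0)

lemma continuousOn_uIcc (hω : IsConcaveModulus ω) {a b : ℝ} (ha : 0 ≤ a) (hb : 0 ≤ b) :
    ContinuousOn ω (Set.uIcc a b) :=
  hω.continuousOn.mono fun _ hx => Set.mem_Ici.2 ((le_min ha hb).trans hx.1)

lemma intervalIntegrable (hω : IsConcaveModulus ω) {a b : ℝ} (ha : 0 ≤ a) (hb : 0 ≤ b) :
    IntervalIntegrable ω volume a b :=
  (hω.continuousOn_uIcc ha hb).intervalIntegrable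

lemma modulusIntegral_sub (hω : IsConcaveModulus ω) {a b : ℝ} (ha : 0 ≤ a) (hb : 0 ≤ b) :
    modulusIntegral ω b - modulusIntegral ω a = ∫ x in a..b, ω x := by
  rw [modulusIntegral, modulusIntegral, sub_eq_iff_eq_add', eq_comm]
  exact intervalIntegral.integral_add_adjacent_intervals (hω.intervalIntegrable le_rfl ha)
    (hω.intervalIntegrable ha hb)

/-- I is convex because its derivative ω is non-decreasing; comparing ω with the constant ω h on
either side of h suffices. -/
lemma tangent_le_modulusIntegral (hω : IsConcaveModulus ω) {x h : ℝ} (hx : 0 ≤ x) (hh : 0 ≤ h) :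
    modulusIntegral ω h + ω h * (x - h) ≤ modulusIntegral ω x := by
  rcases le_total h x with hxh | hxh
  · have h1 : ∫ _ in h..x, ω h ≤ ∫ s in h..x, ω s :=
      intervalIntegral.integral_mono_on hxh (by simp) (hω.intervalIntegrable hh hx)
        fun s hs => hω.mono hh hs.1
    rw [← hω.modulusIntegral_sub hh hx] at h1
    simp only [intervalIntegral.integral_const, smul_eq_mul] at h1
    linarith
  · have h1 : ∫ s in x..h, ω s ≤ ∫ _ in x..h, ω h :=
      intervalIntegral.integral_mono_on hxh (hω.intervalIntegrable hx hh) (by simp)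
        fun s hs => hω.mono (hx.trans hs.1) hs.2
    rw [← hω.modulusIntegral_sub hx hh] at h1
    simp only [intervalIntegral.integral_const, smul_eq_mul] at h1
    linarith

lemma modulusIntegral_nonneg (hω : IsConcaveModulus ω) {x : ℝ} (hx : 0 ≤ x) :
    0 ≤ modulusIntegral ω x :=
  intervalIntegral.integral_nonneg hx fun _ hs => hω.nonneg hs.1

lemma lintegral_Ioc (hω : IsConcaveModulus ω) {a b : ℝ} (ha : 0 ≤ a) (hab : a ≤ b) :
    ∫⁻ v in Set.Ioc a b, ENNReal.ofReal (ω v) =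
      ENNReal.ofReal (modulusIntegral ω b - modulusIntegral ω a) := by
  rw [hω.modulusIntegral_sub ha (ha.trans hab), intervalIntegral.integral_of_le hab,
    ofReal_integral_eq_lintegral_ofReal (hω.intervalIntegrable ha (ha.trans hab)).1]
  exact (ae_restrict_iff' measurableSet_Ioc).2
    (.of_forall fun x hx => hω.nonneg (ha.trans hx.1.le))

end IsConcaveModulus

/-! ### Random times and essential bounds. -/

section Basic

variable {Ω : Type*} [MeasurableSpace Ω] {P : Measure Ω}

lemma integral_unitInterval_eq (f : unitInterval → ℝ) :
    ∫ t, f t = ∫ t in (0 : ℝ)..1, f (Set.projIcc 0 1 zero_le_one t) := by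
  rw [intervalIntegral.integral_of_le zero_le_one, ← integral_Icc_eq_integral_Ioc,
    ← integral_subtype measurableSet_Icc]
  congr 1
  ext t
  rw [Set.projIcc_val]

lemma essSup_nonneg_of_forall [NeZero P] {f : Ω → ℝ} (hf : ∀ w, 0 ≤ f w) {C : ℝ}
    (hC : ∀ w, f w ≤ C) : 0 ≤ essSup f P := by
  have h := ae_le_essSup (μ := P) (f := f) ⟨C, by simpa using Filter.Eventually.of_forall hC⟩
  obtain ⟨w, hw⟩ := h.exists
  exact (hf w).trans hw

lemma abs_projIcc_sub_le (x y : ℝ) :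
    |(Set.projIcc (0 : ℝ) 1 zero_le_one x : ℝ) - Set.projIcc (0 : ℝ) 1 zero_le_one y| ≤ |x - y| := by
  simpa [Real.dist_eq, Subtype.dist_eq] using
    (LipschitzWith.projIcc (zero_le_one (α := ℝ))).dist_le_mul x y

lemma abs_coe_sub_coe_le_one (x y : unitInterval) : |(x : ℝ) - y| ≤ 1 :=
  abs_le.2 ⟨by linarith [x.2.1, y.2.2], by linarith [x.2.2, y.2.1]⟩

lemma essSup_abs_sub_nonneg [NeZero P] (σ θ : RandomTime Ω) :
    0 ≤ essSup (fun w => |(σ.1 w : ℝ) - (θ.1 w : ℝ)|) P :=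
  essSup_nonneg_of_forall (fun _ => abs_nonneg _) fun _ => abs_coe_sub_coe_le_one _ _

lemma ae_abs_sub_le_essSup (σ θ : RandomTime Ω) :
    ∀ᵐ w ∂P, |(σ.1 w : ℝ) - θ.1 w| ≤ essSup (fun w => |(σ.1 w : ℝ) - (θ.1 w : ℝ)|) P :=
  ae_le_essSup (f := fun w => |(σ.1 w : ℝ) - (θ.1 w : ℝ)|)
    ⟨1, by simpa using Filter.Eventually.of_forall fun _ => abs_coe_sub_coe_le_one _ _⟩

lemma lintegral_sample_sub_le [NeZero P] {ω : ℝ → ℝ} (hω : IsConcaveModulus ω)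
    {ξ : MeasurableProcess Ω} (hξ : ξ ∈ processClass P ω) (σ θ : RandomTime Ω) {r : ℝ}
    (hr : ∀ᵐ w ∂P, |(σ.1 w : ℝ) - θ.1 w| ≤ r) :
    ∫⁻ w, ‖(sample ξ σ).1 w - (sample ξ θ).1 w‖ₑ ∂P ≤ ENNReal.ofReal (ω r) := by
  refine (hξ σ θ).trans (ENNReal.ofReal_le_ofReal (hω.mono (essSup_abs_sub_nonneg σ θ) ?_))
  -- The real-valued `essSup` is a conditional infimum, so the a.e. upper bounds must be bounded
  -- below; 0 works since `P` is nonzero.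
  exact essSup_le_of_ae_le r hr ⟨0, fun a ha => by
    obtain ⟨w, hw⟩ := (Filter.eventually_map.1 ha).exists
    exact (abs_nonneg _).trans hw⟩

end Basic

/-! ### Distance to the nearest node. -/

section NodeDist

variable {n : ℕ}

/-- The distance from `x` to the nearest of the nodes `a k`. -/
noncomputable def nodeDist (a : Fin n → ℝ) (x : ℝ) : ℝ := ⨅ k, |x - a k|

lemma nodeDist_le (a : Fin n → ℝ) (x : ℝ) (k : Fin n) : nodeDist a x ≤ |x - a k| :=
  ciInf_le (Set.finite_range _).bddBelow k

lemma le_nodeDist [NeZero n] {a : Fin n → ℝ} {x c : ℝ} (h : ∀ k, c ≤ |x - a k|) : c ≤ nodeDist a x :=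
  le_ciInf h

lemma nodeDist_nonneg [NeZero n] (a : Fin n → ℝ) (x : ℝ) : 0 ≤ nodeDist a x :=
  le_nodeDist fun _ => abs_nonneg _

lemma nodeDist_self [NeZero n] (a : Fin n → ℝ) (k : Fin n) : nodeDist a (a k) = 0 :=
  le_antisymm ((nodeDist_le a _ k).trans (by simp)) (nodeDist_nonneg _ _)

lemma nodeDist_le_add [NeZero n] {a b : Fin n → ℝ} {x y d : ℝ} (h : ∀ k, |x - a k| ≤ |y - b k| + d) :
    nodeDist a x ≤ nodeDist b y + d := by
  rw [← sub_le_iff_le_add]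
  exact le_nodeDist fun k => by linarith [nodeDist_le a x k, h k]

lemma abs_nodeDist_sub_le [NeZero n] (a : Fin n → ℝ) (x y : ℝ) :
    |nodeDist a x - nodeDist a y| ≤ |x - y| := by
  have key : ∀ x y : ℝ, nodeDist a x ≤ nodeDist a y + |x - y| := fun x y =>
    nodeDist_le_add fun k => by
      have := abs_sub_le x y (a k)
      linarith
  rw [abs_le]
  constructor
  · linarith [key y x, abs_sub_comm x y]
  · linarith [key x y]

lemma continuous_nodeDist [NeZero n] (a : Fin n → ℝ) : Continuous (nodeDist a) :=
  (LipschitzWith.of_dist_le_mul (K := 1) fun x y => by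
    simpa [Real.dist_eq] using abs_nodeDist_sub_le a x y).continuous

lemma IsConcaveModulus.continuous_comp_nodeDist [NeZero n] {ω : ℝ → ℝ}
    (hω : IsConcaveModulus ω) (a : Fin n → ℝ) : Continuous fun x => ω (nodeDist a x) := by
  simpa [Function.comp_def, max_eq_left (nodeDist_nonneg a _)] using
    hω.continuous_max.comp (continuous_nodeDist a)

end NodeDist

/-! ### Lower estimates for the integral of ω(distance to the nodes). -/

section LowerIntegral

variable {ω : ℝ → ℝ}

/-- With no node inside (x, y), the node distance is at least the distance to the nearer endpoint.
Halving at the midpoint gives 2 I((y - x)/2), and the tangent at h makes this affine in the gap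
length. -/
lemma IsConcaveModulus.le_integral_gap (hω : IsConcaveModulus ω) {n : ℕ} [NeZero n]
    {a : Fin n → ℝ} {x y h : ℝ} (hxy : x ≤ y) (hh : 0 ≤ h) (ha : ∀ k, a k ≤ x ∨ y ≤ a k) :
    2 * modulusIntegral ω h + ω h * (y - x - 2 * h) ≤ ∫ u in x..y, ω (nodeDist a u) := by
  have hc := hω.continuous_comp_nodeDist a
  set z := (x + y) / 2 with hz
  have hzx : z - x = (y - x) / 2 := by rw [hz]; ring
  have hyz : y - z = (y - x) / 2 := by rw [hz]; ring
  have hd : 0 ≤ (y - x) / 2 := by linarith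
  rw [← intervalIntegral.integral_add_adjacent_intervals (hc.intervalIntegrable x z)
    (hc.intervalIntegrable z y)]
  have e1 : ∫ u in x..z, ω (u - x) = modulusIntegral ω ((y - x) / 2) := by
    rw [intervalIntegral.integral_comp_sub_right (fun u => ω u), hzx, sub_self, modulusIntegral]
  have e2 : ∫ u in z..y, ω (y - u) = modulusIntegral ω ((y - x) / 2) := by
    rw [intervalIntegral.integral_comp_sub_left (fun u => ω u), hyz, sub_self, modulusIntegral]
  have c1 : IntervalIntegrable (fun u => ω (u - x)) volume x z := by
    refine ContinuousOn.intervalIntegrable (hω.continuousOn.comp (by fun_prop) fun u hu => ?_)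
    rw [Set.uIcc_of_le (by linarith)] at hu
    exact Set.mem_Ici.2 (by linarith [hu.1])
  have c2 : IntervalIntegrable (fun u => ω (y - u)) volume z y := by
    refine ContinuousOn.intervalIntegrable (hω.continuousOn.comp (by fun_prop) fun u hu => ?_)
    rw [Set.uIcc_of_le (by linarith)] at hu
    exact Set.mem_Ici.2 (by linarith [hu.2])
  have i1 : ∫ u in x..z, ω (u - x) ≤ ∫ u in x..z, ω (nodeDist a u) := by
    refine intervalIntegral.integral_mono_on (by linarith) c1 (hc.intervalIntegrable x z)
      fun u hu => hω.mono (by linarith [hu.1]) (le_nodeDist fun k => ?_)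
    rcases ha k with h | h
    · exact le_trans (by linarith) (le_abs_self _)
    · exact le_trans (by linarith [hu.2]) (neg_le_abs _)
  have i2 : ∫ u in z..y, ω (y - u) ≤ ∫ u in z..y, ω (nodeDist a u) := by
    refine intervalIntegral.integral_mono_on (by linarith) c2 (hc.intervalIntegrable z y)
      fun u hu => hω.mono (by linarith [hu.2]) (le_nodeDist fun k => ?_)
    rcases ha k with h | h
    · exact le_trans (by linarith [hu.1]) (le_abs_self _)
    · exact le_trans (by linarith) (neg_le_abs _)
  have := hω.tangent_le_modulusIntegral hd hh
  rw [e1] at i1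
  rw [e2] at i2
  nlinarith

/-- The gap bounds are affine with a common slope, so they telescope and only the last delay
survives. -/
lemma IsConcaveModulus.le_integral_nodeDist (hω : IsConcaveModulus ω) {N : ℕ}
    {t : Fin (N + 1) → ℝ} (ht0 : t 0 = 0) (ht : StrictMono t) {s h : ℝ} (hs : 0 ≤ s)
    (hs1 : s + t (Fin.last N) ≤ 1) (hh : 0 ≤ h) :
    modulusIntegral ω s + (2 * N * modulusIntegral ω h + ω h * (t (Fin.last N) - 2 * N * h)) +
        modulusIntegral ω (1 - s - t (Fin.last N)) ≤
      ∫ u in (0 : ℝ)..1, ω (nodeDist (fun k => s + t k) u) := by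
  set a : Fin (N + 1) → ℝ := fun k => s + t k with ha
  have hc := hω.continuous_comp_nodeDist a
  -- Nodes reindexed by ℕ for the telescoping sum; the reduction mod N + 1 is harmless, as only
  -- indices up to N occur.
  set b : ℕ → ℝ := fun k => s + t (Fin.ofNat (N + 1) k) with hb
  have hb0 : b 0 = s := by
    simp [hb, ht0]
  have hbN : b N = s + t (Fin.last N) := by
    simp [hb]
  have ht0' : ∀ k, 0 ≤ t k := fun k => ht0 ▸ ht.monotone (Fin.zero_le k)
  have htl : ∀ k, t k ≤ t (Fin.last N) := fun k => ht.monotone (Fin.le_last k)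
  rw [← intervalIntegral.integral_add_adjacent_intervals (hc.intervalIntegrable 0 (b N))
    (hc.intervalIntegrable (b N) 1), ← intervalIntegral.integral_add_adjacent_intervals
    (hc.intervalIntegrable 0 (b 0)) (hc.intervalIntegrable (b 0) (b N)),
    ← intervalIntegral.sum_integral_adjacent_intervals (fun k _ => hc.intervalIntegrable _ _)]
  refine add_le_add (add_le_add ?_ ?_) ?_
  · rw [hb0]
    have e : ∫ u in (0 : ℝ)..s, ω (s - u) = modulusIntegral ω s := by
      rw [intervalIntegral.integral_comp_sub_left (fun u => ω u), sub_zero, sub_self,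
        modulusIntegral]
    rw [← e]
    refine intervalIntegral.integral_mono_on hs ?_ (hc.intervalIntegrable _ _)
      fun u hu => hω.mono (by linarith [hu.2]) (le_nodeDist fun k => ?_)
    · refine ContinuousOn.intervalIntegrable (hω.continuousOn.comp (by fun_prop) fun u hu => ?_)
      rw [Set.uIcc_of_le hs] at hu
      exact Set.mem_Ici.2 (by linarith [hu.2])
    · exact le_trans (by simp only [ha]; linarith [ht0' k]) (neg_le_abs _)
  · have key : ∀ k ∈ Finset.range N, 2 * modulusIntegral ω h + ω h * (b (k + 1) - b k - 2 * h) ≤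
        ∫ u in b k..b (k + 1), ω (nodeDist a u) := by
      intro k hk
      have hk' := Finset.mem_range.1 hk
      have v1 : ((Fin.ofNat (N + 1) k : Fin (N + 1)) : ℕ) = k := Nat.mod_eq_of_lt (by omega)
      have v2 : ((Fin.ofNat (N + 1) (k + 1) : Fin (N + 1)) : ℕ) = k + 1 :=
        Nat.mod_eq_of_lt (by omega)
      refine hω.le_integral_gap ?_ hh fun j => ?_
      · exact add_le_add le_rfl (ht.monotone (by rw [Fin.le_def, v1, v2]; omega))
      · rcases Nat.lt_or_ge k j with hj | hj
        · exact Or.inr (add_le_add le_rfl (ht.monotone (by rw [Fin.le_def, v2]; omega)))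
        · exact Or.inl (add_le_add le_rfl (ht.monotone (by rw [Fin.le_def, v1]; omega)))
    refine le_trans (le_of_eq ?_) (Finset.sum_le_sum key)
    rw [Finset.sum_add_distrib, ← Finset.mul_sum, ← Finset.mul_sum, Finset.sum_sub_distrib,
      Finset.sum_range_sub, hb0, hbN]
    simp
    ring
  · rw [hbN]
    have e : ∫ u in (s + t (Fin.last N))..1, ω (u - (s + t (Fin.last N))) =
        modulusIntegral ω (1 - s - t (Fin.last N)) := by
      rw [intervalIntegral.integral_comp_sub_right (fun u => ω u), sub_self, modulusIntegral,
        sub_sub]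
    rw [← e]
    refine intervalIntegral.integral_mono_on hs1 ?_ (hc.intervalIntegrable _ _)
      fun u hu => hω.mono (by linarith [hu.1]) (le_nodeDist fun k => ?_)
    · refine ContinuousOn.intervalIntegrable (hω.continuousOn.comp (by fun_prop) fun u hu => ?_)
      rw [Set.uIcc_of_le hs1] at hu
      exact Set.mem_Ici.2 (by linarith [hu.1])
    · exact le_trans (by simp only [ha]; linarith [htl k]) (le_abs_self _)

end LowerIntegral

/-! ### Lower bound for the optimal error by indistinguishable processes. -/

section LowerBound

variable {Ω : Type*} [MeasurableSpace Ω] {P : Measure Ω}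

/-- Both processes give the method the same input, hence the same output `c`, while their integrals
are opposite. By the triangle inequality the two errors add up to at least twice the integral of
`f`. -/
lemma lintegral_le_optimalError {ω : ℝ → ℝ} {n : ℕ} {σ : Fin n → RandomTime Ω}
    {ξ ξ' : MeasurableProcess Ω} (hξ : ξ ∈ processClass P ω) (hξ' : ξ' ∈ processClass P ω)
    (hs : ∀ k, sample ξ' (σ k) = sample ξ (σ k))
    (hneg : ∀ w, ∫ t, ξ'.1 t w = -∫ t, ξ.1 t w) {f : Ω → ENNReal} (hf : Measurable f)
    (hfξ : ∀ᵐ w ∂P, f w ≤ ‖∫ t, ξ.1 t w‖ₑ) :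
    ∫⁻ w, f w ∂P ≤ optimalError P ω σ := by
  refine le_iInf fun φ => ?_
  set c := φ fun k => sample ξ (σ k) with hc
  have h1 : ∫⁻ w, ‖(∫ t, ξ.1 t w) - c.1 w‖ₑ ∂P ≤ methodError P ω σ φ :=
    le_iSup₂ (f := fun ξ (_ : ξ ∈ processClass P ω) =>
      ∫⁻ w, ‖(∫ t : unitInterval, ξ.1 t w) - (φ fun k => sample ξ (σ k)).1 w‖ₑ ∂P) ξ hξ
  have h2 : ∫⁻ w, ‖(∫ t, ξ'.1 t w) - c.1 w‖ₑ ∂P ≤ methodError P ω σ φ := by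
    have := le_iSup₂ (f := fun ξ (_ : ξ ∈ processClass P ω) =>
      ∫⁻ w, ‖(∫ t : unitInterval, ξ.1 t w) - (φ fun k => sample ξ (σ k)).1 w‖ₑ ∂P) ξ' hξ'
    simp only [hs] at this
    exact this
  have hm : Measurable fun w => ‖(∫ t, ξ.1 t w) - c.1 w‖ₑ := by
    have : StronglyMeasurable fun w => ∫ t, ξ.1 t w :=
      (ξ.2.comp measurable_swap).stronglyMeasurable.integral_prod_right'
    exact (this.measurable.sub c.2).enorm
  have h3 : 2 * ∫⁻ w, f w ∂P ≤ 2 * methodError P ω σ φ := by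
    calc 2 * ∫⁻ w, f w ∂P = ∫⁻ w, 2 * f w ∂P := (lintegral_const_mul _ hf).symm
      _ ≤ ∫⁻ w, (‖(∫ t, ξ.1 t w) - c.1 w‖ₑ + ‖(∫ t, ξ'.1 t w) - c.1 w‖ₑ) ∂P := by
        refine lintegral_mono_ae (hfξ.mono fun w hw => ?_)
        calc 2 * f w ≤ ‖∫ t, ξ.1 t w‖ₑ + ‖∫ t, ξ.1 t w‖ₑ := by
              rw [two_mul]; exact add_le_add hw hw
          _ = ‖(∫ t, ξ.1 t w) + ∫ t, ξ.1 t w‖ₑ := by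
              rw [← two_mul, ← two_mul, enorm_mul]
              congr 1
              rw [← ofReal_norm]; simp
          _ = ‖((∫ t, ξ.1 t w) - c.1 w) - ((∫ t, ξ'.1 t w) - c.1 w)‖ₑ := by
              rw [hneg]; congr 1; ring
          _ ≤ _ := enorm_sub_le
      _ = _ := lintegral_add_left hm _
      _ ≤ _ := by rw [two_mul]; exact add_le_add h1 h2
  exact (ENNReal.mul_le_mul_iff_right (by simp) (by simp)).1 h3

/-- The process `c · ω(dist(t, {σ₁, …, σₙ}))`, normalized and localized on the event `A`. -/
noncomputable def bump (P : Measure Ω) {ω : ℝ → ℝ} (hω : IsConcaveModulus ω) {n : ℕ} [NeZero n]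
    (σ : Fin n → RandomTime Ω) {A : Set Ω} (hA : MeasurableSet A) (c : ℝ) :
    MeasurableProcess Ω :=
  ⟨fun x w => A.indicator
    (fun w => c * ((P.real A)⁻¹ * ω (nodeDist (fun k => ((σ k).1 w : ℝ)) x))) w, by
    have h1 : Measurable fun q : unitInterval × Ω =>
        nodeDist (fun k => ((σ k).1 q.2 : ℝ)) (q.1 : ℝ) :=
      Measurable.iInf fun k => by
        have h := (σ k).2
        have h' : Measurable fun q : unitInterval × Ω => ((σ k).1 q.2 : ℝ) :=
          measurable_subtype_coe.comp (h.comp measurable_snd)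
        exact ((measurable_subtype_coe.comp measurable_fst).sub h').norm
    have h2 : Measurable fun q : unitInterval × Ω =>
        ω (nodeDist (fun k => ((σ k).1 q.2 : ℝ)) (q.1 : ℝ)) := by
      simpa [Function.comp_def, max_eq_left (nodeDist_nonneg _ _)] using
        hω.continuous_max.measurable.comp h1
    exact ((h2.const_mul _).const_mul c).indicator (measurable_snd hA)⟩

variable {ω : ℝ → ℝ} {n : ℕ} [NeZero n]

/-- On A the increments are at most ω(r)/P(A) by subadditivity of ω and the 1-Lipschitz node
distance; integrating over A cancels P(A). -/
lemma bump_mem_processClass [IsFiniteMeasure P] (hω : IsConcaveModulus ω)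
    (σ : Fin n → RandomTime Ω) {A : Set Ω} (hA : MeasurableSet A) (hPA : P A ≠ 0) {c : ℝ}
    (hc : |c| = 1) : bump P hω σ hA c ∈ processClass P ω := by
  intro θ ρ
  have : NeZero P := ⟨fun h => hPA (by simp [h])⟩
  set r := essSup (fun w => |(θ.1 w : ℝ) - (ρ.1 w : ℝ)|) P with hr
  have hp : 0 < P.real A := ENNReal.toReal_pos hPA (measure_ne_top P A)
  have hr0 : 0 ≤ r := essSup_abs_sub_nonneg θ ρ
  calc _ ≤ ∫⁻ w, A.indicator (fun _ => ENNReal.ofReal ((P.real A)⁻¹ * ω r)) w ∂P := by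
        refine lintegral_mono_ae ((ae_abs_sub_le_essSup θ ρ).mono fun w hw => ?_)
        by_cases hwA : w ∈ A
        · simp only [sample, bump, Set.indicator_of_mem hwA]
          rw [← ofReal_norm]
          refine ENNReal.ofReal_le_ofReal ?_
          rw [← mul_sub, ← mul_sub, norm_mul, norm_mul, Real.norm_eq_abs, hc, one_mul,
            Real.norm_eq_abs, abs_of_pos (inv_pos.2 hp)]
          refine mul_le_mul_of_nonneg_left ?_ (inv_pos.2 hp).le
          exact hω.sub_le (nodeDist_nonneg _ _) (nodeDist_nonneg _ _)
            ((abs_nodeDist_sub_le _ _ _).trans hw)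
        · simp [sample, bump, Set.indicator_of_notMem hwA]
    _ = ENNReal.ofReal ((P.real A)⁻¹ * ω r) * P A := lintegral_indicator_const hA _
    _ = ENNReal.ofReal (ω r) := by
        rw [← ENNReal.ofReal_toReal (measure_ne_top P A), ← ENNReal.ofReal_mul
          (mul_nonneg (inv_pos.2 hp).le (hω.nonneg hr0)), ← measureReal_def]
        congr 1
        field_simp

lemma sample_bump (hω : IsConcaveModulus ω)
    (σ : Fin n → RandomTime Ω) {A : Set Ω} (hA : MeasurableSet A) (c : ℝ) (k : Fin n) :
    (sample (bump P hω σ hA c) (σ k)).1 = 0 := by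
  ext w
  have : nodeDist (fun k => ((σ k).1 w : ℝ)) ((σ k).1 w) = 0 :=
    nodeDist_self (fun k => ((σ k).1 w : ℝ)) k
  simp [sample, bump, this, hω.map_zero]

lemma integral_bump (hω : IsConcaveModulus ω)
    (σ : Fin n → RandomTime Ω) {A : Set Ω} (hA : MeasurableSet A) (c : ℝ) {w : Ω} (hw : w ∈ A) :
    ∫ x, (bump P hω σ hA c).1 x w = c * ((P.real A)⁻¹ *
      ∫ x in (0 : ℝ)..1, ω (nodeDist (fun k => ((σ k).1 w : ℝ)) x)) := by
  simp only [bump, Set.indicator_of_mem hw]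
  rw [integral_const_mul, integral_const_mul,
    integral_unitInterval_eq fun x => ω (nodeDist (fun k => ((σ k).1 w : ℝ)) x)]
  congr 2
  refine intervalIntegral.integral_congr fun x hx => ?_
  rw [Set.uIcc_of_le zero_le_one] at hx
  simp [Set.projIcc_of_mem zero_le_one hx]

/-- On the event, the actual nodes differ from s + tₖ by at most ε, which costs ω(ε) in the
integrand. -/
lemma ofReal_integral_nodeDist_sub_le_delayError [IsFiniteMeasure P] (hω : IsConcaveModulus ω)
    {τ : RandomTime Ω} {t : Fin n → ℝ} (ht : t ∈ admissibleDelays P τ n) {s ε : ℝ} (hε : 0 ≤ ε)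
    (hs : P {w | |(τ.1 w : ℝ) - s| ≤ ε} ≠ 0) :
    ENNReal.ofReal ((∫ x in (0 : ℝ)..1, ω (nodeDist (fun k => s + t k) x)) - ω ε) ≤
      delayError P ω τ t := by
  set A := {w | |(τ.1 w : ℝ) - s| ≤ ε} with hAdef
  have hτ : Measurable fun w => (τ.1 w : ℝ) := measurable_subtype_coe.comp τ.2
  have hA : MeasurableSet A := measurableSet_le (hτ.sub_const s).norm measurable_const
  set σ : Fin n → RandomTime Ω := fun k => shift τ (t k) with hσ
  have hp : 0 < P.real A := ENNReal.toReal_pos hs (measure_ne_top P A)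
  set G := ∫ x in (0 : ℝ)..1, ω (nodeDist (fun k => s + t k) x) with hG
  have hneg : ∀ w, ∫ x, (bump P hω σ hA (-1)).1 x w = -∫ x, (bump P hω σ hA 1).1 x w := by
    intro w
    by_cases hw : w ∈ A
    · rw [integral_bump hω σ hA _ hw, integral_bump hω σ hA _ hw]; ring
    · simp [bump, Set.indicator_of_notMem hw]
  have key := lintegral_le_optimalError (bump_mem_processClass hω σ hA hs (c := 1) (by simp))
    (bump_mem_processClass hω σ hA hs (c := -1) (by simp))
    (σ := σ) (fun k => Subtype.ext (by rw [sample_bump, sample_bump])) hneg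
    (f := A.indicator fun _ => ENNReal.ofReal ((P.real A)⁻¹ * (G - ω ε)))
    (measurable_const.indicator hA) (by
      filter_upwards [ae_all_iff.2 ht.2.2] with w hw
      by_cases hwA : w ∈ A
      · rw [Set.indicator_of_mem hwA, integral_bump hω σ hA _ hwA, one_mul,
          ← ofReal_norm]
        refine ENNReal.ofReal_le_ofReal (le_trans ?_ (le_abs_self _))
        refine mul_le_mul_of_nonneg_left ?_ (inv_pos.2 hp).le
        have hc1 := hω.continuous_comp_nodeDist fun k => s + t k
        have hc2 := hω.continuous_comp_nodeDist fun k => ((σ k).1 w : ℝ)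
        have : G ≤ ∫ x in (0 : ℝ)..1, (ω (nodeDist (fun k => ((σ k).1 w : ℝ)) x) + ω ε) := by
          refine intervalIntegral.integral_mono_on zero_le_one (hc1.intervalIntegrable _ _)
            ((hc2.add continuous_const).intervalIntegrable _ _) fun x _ => ?_
          refine (hω.mono (nodeDist_nonneg _ _) ?_).trans
            (hω.add_le (nodeDist_nonneg _ _) hε)
          refine nodeDist_le_add fun k => ?_
          have ht0 : 0 ≤ t k := ht.1 ▸ ht.2.1.monotone (Fin.zero_le k)
          have e : ((σ k).1 w : ℝ) = τ.1 w + t k := by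
            have hmem : (τ.1 w : ℝ) + t k ∈ Set.Icc (0 : ℝ) 1 :=
              ⟨add_nonneg (τ.1 w).2.1 ht0, hw k⟩
            simp [hσ, shift, Set.projIcc_of_mem zero_le_one hmem]
          rw [e]
          have h1 := abs_sub_le x (τ.1 w + t k) (s + t k)
          have h2 : |(τ.1 w : ℝ) + t k - (s + t k)| ≤ ε := by
            rw [add_sub_add_right_eq_sub]; exact hwA
          linarith
        rw [intervalIntegral.integral_add (hc2.intervalIntegrable _ _)
          (continuous_const.intervalIntegrable _ _)] at this
        simp only [intervalIntegral.integral_const, sub_zero, one_smul] at this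
        linarith
      · simp [Set.indicator_of_notMem hwA])
  refine le_trans (le_of_eq ?_) key
  rw [lintegral_indicator_const hA, ← ENNReal.ofReal_toReal (measure_ne_top P A),
    mul_comm, ← ENNReal.ofReal_mul ENNReal.toReal_nonneg, ← measureReal_def]
  congr 1
  field_simp

lemma ofReal_integral_nodeDist_le_delayError [IsFiniteMeasure P] (hω : IsConcaveModulus ω)
    {τ : RandomTime Ω} {t : Fin n → ℝ} (ht : t ∈ admissibleDelays P τ n) {s : ℝ}
    (hs : ∀ ε > 0, P {w | |(τ.1 w : ℝ) - s| ≤ ε} ≠ 0) :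
    ENNReal.ofReal (∫ x in (0 : ℝ)..1, ω (nodeDist (fun k => s + t k) x)) ≤
      delayError P ω τ t := by
  set G := ∫ x in (0 : ℝ)..1, ω (nodeDist (fun k => s + t k) x)
  have h1 : Filter.Tendsto ω (nhdsWithin 0 (Set.Ioi 0)) (nhds 0) := by
    have := hω.continuousOn 0 (Set.mem_Ici.2 le_rfl)
    rw [ContinuousWithinAt, hω.map_zero] at this
    exact this.mono_left (nhdsWithin_mono _ Set.Ioi_subset_Ici_self)
  have h2 : Filter.Tendsto (fun ε => ENNReal.ofReal (G - ω ε)) (nhdsWithin 0 (Set.Ioi 0))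
      (nhds (ENNReal.ofReal G)) := by
    have := ENNReal.tendsto_ofReal (h1.const_sub G)
    rwa [sub_zero] at this
  refine le_of_tendsto h2 (eventually_nhdsWithin_of_forall fun ε hε => ?_)
  exact ofReal_integral_nodeDist_sub_le_delayError hω ht (le_of_lt hε) (hs ε hε)

/-- A lower bound for the error, from the tangent lines of the convex function `modulusIntegral ω`
at `h` and `r`. -/
lemma tangent_le_delayError [IsFiniteMeasure P] (hω : IsConcaveModulus ω) {N : ℕ}
    [NeZero (N + 1)] {τ : RandomTime Ω} {t : Fin (N + 1) → ℝ}
    (ht : t ∈ admissibleDelays P τ (N + 1)) {s h r : ℝ}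
    (hs : ∀ ε > 0, P {w | |(τ.1 w : ℝ) - s| ≤ ε} ≠ 0) (hs0 : 0 ≤ s)
    (hs1 : s + t (Fin.last N) ≤ 1) (hh : 0 ≤ h) (hr : 0 ≤ r) :
    ENNReal.ofReal (modulusIntegral ω s +
        (2 * N * modulusIntegral ω h + ω h * (t (Fin.last N) - 2 * N * h)) +
        (modulusIntegral ω r + ω r * (1 - s - t (Fin.last N) - r))) ≤ delayError P ω τ t := by
  refine le_trans (ENNReal.ofReal_le_ofReal ?_) (ofReal_integral_nodeDist_le_delayError hω ht hs)
  refine le_trans (add_le_add le_rfl ?_) (hω.le_integral_nodeDist ht.1 ht.2.1 hs0 hs1 hh)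
  exact hω.tangent_le_modulusIntegral (by linarith) hr

end LowerBound

/-! ### Changes of variable and quadrature in extended non-negative reals. -/

section Lintegral

lemma lintegral_Ioc_add (F : ℝ → ENNReal) (a b c : ℝ) :
    ∫⁻ t in Set.Ioc (a + c) (b + c), F t = ∫⁻ v in Set.Ioc a b, F (v + c) := by
  have := (measurePreserving_add_right volume c).setLIntegral_comp_preimage_emb
    (measurableEmbedding_addRight c) F (Set.Ioc (a + c) (b + c))
  simpa using this.symm

lemma lintegral_Ioc_sub (F : ℝ → ENNReal) (a b c : ℝ) :
    ∫⁻ t in Set.Ioc (c - b) (c - a), F t = ∫⁻ v in Set.Ioc a b, F (c - v) := by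
  have := (Measure.measurePreserving_sub_left volume c).setLIntegral_comp_preimage_emb
    (measurableEmbedding_subLeft c) F (Set.Ioc (c - b) (c - a))
  simp only [Set.preimage_const_sub_Ioc, sub_sub_cancel] at this
  rw [← this]
  exact setLIntegral_congr Ico_ae_eq_Ioc

lemma lintegral_Ioc_split (F : ℝ → ENNReal) {a b c : ℝ} (hab : a ≤ b) (hbc : b ≤ c) :
    ∫⁻ t in Set.Ioc a c, F t = (∫⁻ t in Set.Ioc a b, F t) + ∫⁻ t in Set.Ioc b c, F t := by
  rw [← Set.Ioc_union_Ioc_eq_Ioc hab hbc, lintegral_union measurableSet_Ioc]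
  exact Set.Ioc_disjoint_Ioc_of_le le_rfl

/-- The error of a quadrature rule with step-function weights. -/
lemma enorm_integral_sub_sum_le {g : ℝ → ℝ} (hg : Measurable g) (c y : ℕ → ℝ) (n : ℕ)
    (hc : ∀ k < n, c k ≤ c (k + 1)) :
    ‖(∫ t in c 0..c n, g t) - ∑ k ∈ Finset.range n, (c (k + 1) - c k) * y k‖ₑ ≤
      ∑ k ∈ Finset.range n, ∫⁻ t in Set.Ioc (c k) (c (k + 1)), ‖g t - y k‖ₑ := by
  -- Integrability of g need not be assumed: if some piece on the right is infinite, the bound is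
  -- trivial.
  by_cases hfin : ∀ k < n, ∫⁻ t in Set.Ioc (c k) (c (k + 1)), ‖g t - y k‖ₑ ≠ ⊤
  · have hint : ∀ k < n, IntervalIntegrable (fun t => g t - y k) volume (c k) (c (k + 1)) := by
      intro k hk
      rw [intervalIntegrable_iff_integrableOn_Ioc_of_le (hc k hk)]
      exact ⟨(hg.sub_const _).aestronglyMeasurable, lt_top_iff_ne_top.2 (hfin k hk)⟩
    have hintg : ∀ k < n, IntervalIntegrable g volume (c k) (c (k + 1)) := fun k hk => by
      simpa using (hint k hk).add (intervalIntegrable_const (c := y k))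
    rw [← intervalIntegral.sum_integral_adjacent_intervals hintg, ← Finset.sum_sub_distrib]
    refine (enorm_sum_le _ _).trans (Finset.sum_le_sum fun k hk => ?_)
    have hk' := Finset.mem_range.1 hk
    have e : (∫ t in c k..c (k + 1), g t) - (c (k + 1) - c k) * y k =
        ∫ t in c k..c (k + 1), (g t - y k) := by
      rw [intervalIntegral.integral_sub (hintg k hk') intervalIntegrable_const]
      simp
    rw [e, intervalIntegral.integral_of_le (hc k hk')]
    exact enorm_integral_le_lintegral_enorm _
  · push Not at hfin
    obtain ⟨k, hk, h⟩ := hfin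
    rw [(ENNReal.sum_eq_top).2 ⟨k, Finset.mem_range.2 hk, h⟩]
    exact le_top

end Lintegral

/-- The projection of `ℝ` onto `[0, 1]`. -/
noncomputable abbrev unitProj (t : ℝ) : unitInterval := Set.projIcc (0 : ℝ) 1 zero_le_one t

lemma measurable_unitProj : Measurable unitProj := continuous_projIcc.measurable

/-! ### Integrated increments between families of random times. -/

section Increments

variable {Ω : Type*} [MeasurableSpace Ω] {P : Measure Ω} {ω : ℝ → ℝ}

/-- The integral over `v ∈ (a, b]` of the increments `|ξ_{U v} - ξ_{V v}|`. -/
noncomputable def incrementIntegral (ξ : MeasurableProcess Ω) (a b : ℝ)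
    (U V : ℝ → Ω → unitInterval) (w : Ω) : ENNReal :=
  ∫⁻ v in Set.Ioc a b, ‖ξ.1 (U v w) w - ξ.1 (V v w) w‖ₑ

lemma measurable_increment (ξ : MeasurableProcess Ω) {U V : ℝ → Ω → unitInterval}
    (hU : Measurable (Function.uncurry U)) (hV : Measurable (Function.uncurry V)) :
    Measurable fun q : Ω × ℝ => ‖ξ.1 (U q.2 q.1) q.1 - ξ.1 (V q.2 q.1) q.1‖ₑ :=
  ((ξ.2.comp ((hU.comp measurable_swap).prodMk measurable_fst)).sub
    (ξ.2.comp ((hV.comp measurable_swap).prodMk measurable_fst))).enorm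

lemma measurable_incrementIntegral (ξ : MeasurableProcess Ω) (a b : ℝ)
    {U V : ℝ → Ω → unitInterval}
    (hU : Measurable (Function.uncurry U)) (hV : Measurable (Function.uncurry V)) :
    Measurable (incrementIntegral ξ a b U V) :=
  (measurable_increment ξ hU hV).lintegral_prod_right'

/-- By Tonelli the expectation can be taken first at fixed v, where the class condition applies to
the random times `U v`, `V v` and gives ω(v). -/
lemma lintegral_incrementIntegral_le [NeZero P] [SFinite P] (hω : IsConcaveModulus ω)
    {ξ : MeasurableProcess Ω} (hξ : ξ ∈ processClass P ω) {a b : ℝ} (ha : 0 ≤ a) (hab : a ≤ b)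
    {U V : ℝ → Ω → unitInterval}
    (hU : Measurable (Function.uncurry U)) (hV : Measurable (Function.uncurry V))
    (hUV : ∀ v ∈ Set.Ioc a b, ∀ᵐ w ∂P, |(U v w : ℝ) - V v w| ≤ v) :
    ∫⁻ w, incrementIntegral ξ a b U V w ∂P ≤
      ENNReal.ofReal (modulusIntegral ω b - modulusIntegral ω a) := by
  rw [← hω.lintegral_Ioc ha hab]
  simp only [incrementIntegral]
  rw [lintegral_lintegral_swap (measurable_increment ξ hU hV).aemeasurable]
  refine setLIntegral_mono' measurableSet_Ioc fun v hv => ?_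
  exact lintegral_sample_sub_le hω hξ ⟨U v, hU.comp measurable_prodMk_left⟩
    ⟨V v, hV.comp measurable_prodMk_left⟩ (hUV v hv)

end Increments

/-! ### Upper bound by a quadrature rule. -/

section UpperBound

variable {Ω : Type*} [MeasurableSpace Ω] {P : Measure Ω} {ω : ℝ → ℝ}

/-- The integral of the increments over an interval between two consecutive half-steps equals
an integral over the distance to the node. -/
lemma exists_incrementIntegral_eq (ξ : MeasurableProcess Ω) {T : Ω → ℝ} (hT : Measurable T)
    (h : ℝ) (j : ℕ) :
    ∃ U V : ℝ → Ω → unitInterval, Measurable (Function.uncurry U) ∧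
      Measurable (Function.uncurry V) ∧ (∀ v ≥ 0, ∀ w, |(U v w : ℝ) - V v w| ≤ v) ∧
      ∀ w, ∫⁻ t in Set.Ioc (T w + j * h) (T w + (j + 1) * h),
        ‖ξ.1 (unitProj t) w - ξ.1 (unitProj (T w + 2 * ((j + 1) / 2 : ℕ) * h)) w‖ₑ =
          incrementIntegral ξ 0 h U V w := by
  have hT' : Measurable fun q : ℝ × Ω => T q.2 := hT.comp measurable_snd
  -- For even j the half-cell lies to the right of its node and v is a translation; for odd j it
  -- lies to the left, so v runs backwards from the node.
  rcases Nat.even_or_odd' j with ⟨i, rfl | rfl⟩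
  · refine ⟨fun v w => unitProj (v + (T w + (2 * i : ℕ) * h)),
      fun _ w => unitProj (T w + 2 * ((2 * i + 1) / 2 : ℕ) * h),
      measurable_unitProj.comp (measurable_fst.add (hT'.add_const _)),
      measurable_unitProj.comp (hT'.add_const _), fun v hv w => ?_, fun w => ?_⟩
    · refine (abs_projIcc_sub_le _ _).trans (le_of_eq ?_)
      rw [show (2 * i + 1) / 2 = i by omega]
      push_cast
      rw [add_sub_cancel_right, abs_of_nonneg hv]
    · rw [incrementIntegral, ← lintegral_Ioc_add (fun t => ‖ξ.1 (unitProj t) w -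
        ξ.1 (unitProj (T w + 2 * ((2 * i + 1) / 2 : ℕ) * h)) w‖ₑ) 0 h]
      congr 3 <;> ring
  · refine ⟨fun v w => unitProj ((T w + ((2 * i + 1 : ℕ) + 1) * h) - v),
      fun _ w => unitProj (T w + 2 * ((2 * i + 1 + 1) / 2 : ℕ) * h),
      measurable_unitProj.comp ((hT'.add_const _).sub measurable_fst),
      measurable_unitProj.comp (hT'.add_const _), fun v hv w => ?_, fun w => ?_⟩
    · refine (abs_projIcc_sub_le _ _).trans (le_of_eq ?_)
      rw [show (2 * i + 1 + 1) / 2 = i + 1 by omega]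
      push_cast
      rw [show T w + (2 * (i : ℝ) + 1 + 1) * h - v - (T w + 2 * (i + 1) * h) = -v by ring,
        abs_neg, abs_of_nonneg hv]
    · rw [incrementIntegral, ← lintegral_Ioc_sub (fun t => ‖ξ.1 (unitProj t) w -
        ξ.1 (unitProj (T w + 2 * ((2 * i + 1 + 1) / 2 : ℕ) * h)) w‖ₑ) 0 h]
      congr 3 <;> ring

/-- The partition of `[0, 1]` into the cells of the quadrature rule with nodes `x + 2kh`, each
cell being split in two at its node. -/
noncomputable def cellBoundary (N : ℕ) (h x : ℝ) (j : ℕ) : ℝ :=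
  if j = 0 then 0 else if j = 2 * N + 2 then 1 else x + ((j : ℝ) - 1) * h

lemma cellBoundary_succ {N j : ℕ} (hj : j ≤ 2 * N) (h x : ℝ) :
    cellBoundary N h x (j + 1) = x + j * h := by
  rw [cellBoundary, if_neg (by omega), if_neg (by omega)]
  push_cast
  ring

lemma measurable_cellBoundary (N : ℕ) (h : ℝ) (j : ℕ) {T : Ω → ℝ} (hT : Measurable T) :
    Measurable fun w => cellBoundary N h (T w) j := by
  unfold cellBoundary
  split_ifs
  · exact measurable_const
  · exact measurable_const
  · exact hT.add_const _

/-- The quadrature method with nodes `τ + 2kh` and the cells given by `cellBoundary`. -/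
noncomputable def quadrature (N : ℕ) (h : ℝ) (τ : RandomTime Ω)
    (η : Fin (N + 1) → RandomVariable Ω) : RandomVariable Ω :=
  ⟨fun w => ∑ j ∈ Finset.range (2 * N + 2),
    (cellBoundary N h (τ.1 w) (j + 1) - cellBoundary N h (τ.1 w) j) *
      (η (Fin.ofNat (N + 1) (j / 2))).1 w, by
    have hτ : Measurable fun w => (τ.1 w : ℝ) := measurable_subtype_coe.comp τ.2
    exact Finset.measurable_sum _ fun j _ => ((measurable_cellBoundary N h _ hτ).sub
      (measurable_cellBoundary N h _ hτ)).mul (η _).2⟩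

/-- The two end pieces stay separate from the half-cells because their lengths, τ and A + B - τ, are
random. -/
lemma enorm_integral_sub_quadrature_le {N : ℕ} {h A B : ℝ} (hh : 0 ≤ h) (hA : 0 ≤ A)
    (hsum : 2 * N * h + A + B = 1) (τ : RandomTime Ω) (ξ : MeasurableProcess Ω) {w : Ω}
    (hw : A ≤ (τ.1 w : ℝ)) (hw' : (τ.1 w : ℝ) ≤ B) :
    ‖(∫ t, ξ.1 t w) - (quadrature N h τ
        fun k => sample ξ (shift τ (2 * ((k : ℕ) : ℝ) * h))).1 w‖ₑ ≤
      (∑ j ∈ Finset.range (2 * N),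
        ∫⁻ t in Set.Ioc ((τ.1 w : ℝ) + j * h) (τ.1 w + (j + 1) * h),
          ‖ξ.1 (unitProj t) w - ξ.1 (unitProj (τ.1 w + 2 * ((j + 1) / 2 : ℕ) * h)) w‖ₑ) +
      (∫⁻ t in Set.Ioc (0 : ℝ) (τ.1 w),
          ‖ξ.1 (unitProj t) w - ξ.1 (unitProj (τ.1 w)) w‖ₑ) +
      ∫⁻ t in Set.Ioc ((τ.1 w : ℝ) + 2 * N * h) 1,
          ‖ξ.1 (unitProj t) w - ξ.1 (unitProj (τ.1 w + 2 * N * h)) w‖ₑ := by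
  set x : ℝ := (τ.1 w : ℝ) with hx
  set g : ℝ → ℝ := fun t => ξ.1 (unitProj t) w with hg
  have hgm : Measurable g := ξ.2.comp (measurable_unitProj.prodMk measurable_const)
  set c := cellBoundary N h x with hc
  have c0 : c 0 = 0 := by simp [hc, cellBoundary]
  have cl : c (2 * N + 2) = 1 := by simp [hc, cellBoundary]
  have cs : ∀ j ≤ 2 * N, c (j + 1) = x + j * h := fun j hj => cellBoundary_succ hj h x
  have c1 : c 1 = x := by simpa using cs 0 (by omega)
  have cn : c (2 * N + 1) = x + 2 * N * h := by rw [cs _ le_rfl]; push_cast; ring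
  have hmono : ∀ k < 2 * N + 2, c k ≤ c (k + 1) := by
    intro k hk
    rcases Nat.eq_zero_or_pos k with rfl | hk0
    · rw [c0, c1]; exact hA.trans hw
    · obtain ⟨k, rfl⟩ := Nat.exists_eq_succ_of_ne_zero hk0.ne'
      rcases Nat.lt_or_ge k (2 * N) with hk' | hk'
      · rw [Nat.succ_eq_add_one, cs k hk'.le, cs (k + 1) hk']
        push_cast; linarith
      · obtain rfl : k = 2 * N := by omega
        rw [Nat.succ_eq_add_one, cn, cl]
        linarith
  have key := enorm_integral_sub_sum_le hgm c (fun j => g (x + 2 * (j / 2 : ℕ) * h)) (2 * N + 2)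
    hmono
  refine Eq.trans_le ?_ (key.trans_eq ?_)
  · rw [c0, cl, integral_unitInterval_eq fun t => ξ.1 t w]
    refine congrArg (fun z : ℝ => ‖(∫ t in (0 : ℝ)..1, g t) - z‖ₑ) ?_
    simp only [quadrature]
    refine Finset.sum_congr rfl fun j hj => ?_
    have hj' : j / 2 % (N + 1) = j / 2 :=
      Nat.mod_eq_of_lt (by have := Finset.mem_range.1 hj; omega)
    simp only [sample, shift, Fin.ofNat, hj', hg, hc, hx]
  -- The last and first pieces are peeled off, so the remaining piece j + 1 uses node (j + 1)/2.
  · rw [Finset.sum_range_succ, Finset.sum_range_succ']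
    congr 1
    · congr 1
      · refine Finset.sum_congr rfl fun j hj => ?_
        have hj' := Finset.mem_range.1 hj
        rw [cs j hj'.le, cs (j + 1) hj']
        push_cast
        rfl
      · simp [c0, c1, hg]
    · rw [cn, cl, show (2 * N + 1) / 2 = N by omega]

lemma delayError_le [IsProbabilityMeasure P] (hω : IsConcaveModulus ω) {N : ℕ} {h A B : ℝ}
    (hh : 0 ≤ h) (hA : 0 ≤ A) (hAB : A ≤ B) (hsum : 2 * N * h + A + B = 1) {τ : RandomTime Ω}
    (hτA : ∀ᵐ w ∂P, A ≤ τ.1 w) (hτB : ∀ᵐ w ∂P, (τ.1 w : ℝ) ≤ B) :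
    delayError P ω τ (fun k : Fin (N + 1) => 2 * ((k : ℕ) : ℝ) * h) ≤
      ENNReal.ofReal (2 * N * modulusIntegral ω h + modulusIntegral ω A +
        modulusIntegral ω B) := by
  refine (iInf_le _ (quadrature N h τ)).trans (iSup₂_le fun ξ hξ => ?_)
  have hτ : Measurable fun w => (τ.1 w : ℝ) := measurable_subtype_coe.comp τ.2
  have hτ' : Measurable fun q : ℝ × Ω => (τ.1 q.2 : ℝ) := hτ.comp measurable_snd
  choose U V hU hV hUV hcell using fun j => exists_incrementIntegral_eq ξ hτ h j
  set U₁ : ℝ → Ω → unitInterval := fun v w => unitProj (τ.1 w - v) with hU₁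
  set V₁ : ℝ → Ω → unitInterval := fun _ w => unitProj (τ.1 w) with hV₁
  set U₂ : ℝ → Ω → unitInterval := fun v w => unitProj (v + (τ.1 w + 2 * N * h)) with hU₂
  set V₂ : ℝ → Ω → unitInterval := fun _ w => unitProj (τ.1 w + 2 * N * h) with hV₂
  -- The glued pair: for v ≤ τ it measures the left end at distance v; for v > τ it measures the
  -- right end at distance v - (τ - A), which is at most v since τ ≥ A.
  set U₃ : ℝ → Ω → unitInterval := fun v w =>
    unitProj (if v ≤ τ.1 w then τ.1 w - v else v + (2 * N * h + A)) with hU₃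
  set V₃ : ℝ → Ω → unitInterval := fun v w =>
    unitProj (if v ≤ τ.1 w then (τ.1 w : ℝ) else τ.1 w + 2 * N * h) with hV₃
  have mU₁ : Measurable (Function.uncurry U₁) :=
    measurable_unitProj.comp (hτ'.sub measurable_fst)
  have mV₁ : Measurable (Function.uncurry V₁) := measurable_unitProj.comp hτ'
  have mU₂ : Measurable (Function.uncurry U₂) :=
    measurable_unitProj.comp (measurable_fst.add (hτ'.add_const _))
  have mV₂ : Measurable (Function.uncurry V₂) := measurable_unitProj.comp (hτ'.add_const _)
  have hset : MeasurableSet {q : ℝ × Ω | q.1 ≤ τ.1 q.2} := measurableSet_le measurable_fst hτ'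
  have mU₃ : Measurable (Function.uncurry U₃) := measurable_unitProj.comp
    (Measurable.ite hset (hτ'.sub measurable_fst) (measurable_fst.add_const _))
  have mV₃ : Measurable (Function.uncurry V₃) := measurable_unitProj.comp
    (Measurable.ite hset hτ' (hτ'.add_const _))
  have b₁ : ∀ v ∈ Set.Ioc 0 A, ∀ᵐ w ∂P, |(U₁ v w : ℝ) - V₁ v w| ≤ v := fun v hv =>
    .of_forall fun w => (abs_projIcc_sub_le _ _).trans
      (by rw [sub_sub_cancel_left, abs_neg, abs_of_pos hv.1])
  have b₂ : ∀ v ∈ Set.Ioc 0 A, ∀ᵐ w ∂P, |(U₂ v w : ℝ) - V₂ v w| ≤ v := fun v hv =>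
    .of_forall fun w => (abs_projIcc_sub_le _ _).trans
      (by rw [add_sub_cancel_right, abs_of_pos hv.1])
  have b₃ : ∀ v ∈ Set.Ioc A B, ∀ᵐ w ∂P, |(U₃ v w : ℝ) - V₃ v w| ≤ v := fun v hv => by
    filter_upwards [hτA] with w hw
    refine (abs_projIcc_sub_le _ _).trans ?_
    have hv0 : 0 < v := hA.trans_lt hv.1
    split_ifs with hvw
    · rw [sub_sub_cancel_left, abs_neg, abs_of_pos hv0]
    · rw [abs_le]; constructor <;> linarith
  calc _ ≤ ∫⁻ w, ((∑ j ∈ Finset.range (2 * N), incrementIntegral ξ 0 h (U j) (V j) w) +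
        incrementIntegral ξ 0 A U₁ V₁ w + incrementIntegral ξ 0 A U₂ V₂ w +
        incrementIntegral ξ A B U₃ V₃ w) ∂P := by
        refine lintegral_mono_ae ?_
        filter_upwards [hτA, hτB] with w hw hw'
        refine (enorm_integral_sub_quadrature_le hh hA hsum τ ξ hw hw').trans (le_of_eq ?_)
        rw [Finset.sum_congr rfl fun j _ => hcell j w, add_assoc, add_assoc, add_assoc]
        congr 1
        have e1 : ∫⁻ t in Set.Ioc (0 : ℝ) (τ.1 w),
            ‖ξ.1 (unitProj t) w - ξ.1 (unitProj (τ.1 w)) w‖ₑ =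
            incrementIntegral ξ 0 A U₁ V₁ w + ∫⁻ v in Set.Ioc A (τ.1 w),
              ‖ξ.1 (U₃ v w) w - ξ.1 (V₃ v w) w‖ₑ := by
          have := lintegral_Ioc_sub (fun t => ‖ξ.1 (unitProj t) w - ξ.1 (unitProj (τ.1 w)) w‖ₑ)
            0 (τ.1 w) (τ.1 w)
          rw [sub_self, sub_zero] at this
          rw [this, lintegral_Ioc_split _ hA hw, incrementIntegral]
          congr 1
          refine setLIntegral_congr_fun measurableSet_Ioc fun v hv => ?_
          simp only [hU₃, hV₃, if_pos hv.2]
        have e2 : ∫⁻ t in Set.Ioc ((τ.1 w : ℝ) + 2 * N * h) 1,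
            ‖ξ.1 (unitProj t) w - ξ.1 (unitProj (τ.1 w + 2 * N * h)) w‖ₑ =
            incrementIntegral ξ 0 A U₂ V₂ w + ∫⁻ v in Set.Ioc (τ.1 w : ℝ) B,
              ‖ξ.1 (U₃ v w) w - ξ.1 (V₃ v w) w‖ₑ := by
          rw [lintegral_Ioc_split _ (show (τ.1 w : ℝ) + 2 * N * h ≤ A + (τ.1 w + 2 * N * h) by
            linarith) (by linarith), incrementIntegral]
          congr 1
          · rw [← lintegral_Ioc_add (fun t => ‖ξ.1 (unitProj t) w -
              ξ.1 (unitProj (τ.1 w + 2 * N * h)) w‖ₑ), zero_add]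
          · have := lintegral_Ioc_add (fun t => ‖ξ.1 (unitProj t) w -
              ξ.1 (unitProj (τ.1 w + 2 * N * h)) w‖ₑ) (τ.1 w) B (2 * N * h + A)
            rw [show A + ((τ.1 w : ℝ) + 2 * N * h) = τ.1 w + (2 * N * h + A) by ring,
              show (1 : ℝ) = B + (2 * N * h + A) by linarith, this]
            refine setLIntegral_congr_fun measurableSet_Ioc fun v hv => ?_
            simp only [hU₃, hV₃, if_neg (not_le.2 hv.1)]
        rw [e1, e2, incrementIntegral.eq_def ξ A B, lintegral_Ioc_split _ hw hw']
        abel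
    _ = (∑ j ∈ Finset.range (2 * N), ∫⁻ w, incrementIntegral ξ 0 h (U j) (V j) w ∂P) +
        ∫⁻ w, incrementIntegral ξ 0 A U₁ V₁ w ∂P + ∫⁻ w, incrementIntegral ξ 0 A U₂ V₂ w ∂P +
        ∫⁻ w, incrementIntegral ξ A B U₃ V₃ w ∂P := by
        rw [lintegral_add_right _ (measurable_incrementIntegral ξ A B mU₃ mV₃),
          lintegral_add_right _ (measurable_incrementIntegral ξ 0 A mU₂ mV₂),
          lintegral_add_right _ (measurable_incrementIntegral ξ 0 A mU₁ mV₁),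
          lintegral_finsetSum _ fun j _ => measurable_incrementIntegral ξ 0 h (hU j) (hV j)]
    _ ≤ (∑ j ∈ Finset.range (2 * N),
          ENNReal.ofReal (modulusIntegral ω h - modulusIntegral ω 0)) +
        ENNReal.ofReal (modulusIntegral ω A - modulusIntegral ω 0) +
        ENNReal.ofReal (modulusIntegral ω A - modulusIntegral ω 0) +
        ENNReal.ofReal (modulusIntegral ω B - modulusIntegral ω A) := by
        refine add_le_add (add_le_add (add_le_add (Finset.sum_le_sum fun j _ => ?_) ?_) ?_) ?_
        · exact lintegral_incrementIntegral_le hω hξ le_rfl hh (hU j) (hV j)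
            fun v hv => .of_forall (hUV j v hv.1.le)
        · exact lintegral_incrementIntegral_le hω hξ le_rfl hA mU₁ mV₁ b₁
        · exact lintegral_incrementIntegral_le hω hξ le_rfl hA mU₂ mV₂ b₂
        · exact lintegral_incrementIntegral_le hω hξ hA hAB mU₃ mV₃ b₃
    _ = _ := by
        have h0 : modulusIntegral ω 0 = 0 := by simp [modulusIntegral]
        have hIA := hω.modulusIntegral_nonneg hA
        have hIh := hω.modulusIntegral_nonneg hh
        have hIB : 0 ≤ modulusIntegral ω B - modulusIntegral ω A := by
          rw [hω.modulusIntegral_sub hA (hA.trans hAB)]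
          exact intervalIntegral.integral_nonneg hAB fun u hu => hω.nonneg (hA.trans hu.1)
        rw [h0, sub_zero, sub_zero, ← ENNReal.ofReal_sum_of_nonneg fun _ _ => hIh,
          Finset.sum_const, Finset.card_range, nsmul_eq_mul,
          ← ENNReal.ofReal_add (by positivity) hIA, ← ENNReal.ofReal_add (by positivity) hIA,
          ← ENNReal.ofReal_add (by positivity) hIB]
        congr 1
        push_cast
        ring

end UpperBound

/-! ### The essential bounds of τ lie in its essential range. -/

section EssentialRange

variable {Ω : Type*} [MeasurableSpace Ω] {P : Measure Ω}

lemma ae_le_essSup_randomTime (τ : RandomTime Ω) :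
    ∀ᵐ w ∂P, (τ.1 w : ℝ) ≤ essSup (fun w => (τ.1 w : ℝ)) P :=
  ae_le_essSup (f := fun w => (τ.1 w : ℝ))
    ⟨1, by simpa using Filter.Eventually.of_forall fun w => (τ.1 w).2.2⟩

lemma ae_essInf_le_randomTime (τ : RandomTime Ω) :
    ∀ᵐ w ∂P, essInf (fun w => (τ.1 w : ℝ)) P ≤ τ.1 w :=
  ae_essInf_le (f := fun w => (τ.1 w : ℝ))
    ⟨0, by simpa using Filter.Eventually.of_forall fun w => (τ.1 w).2.1⟩

lemma essSup_randomTime_le [NeZero P] (τ : RandomTime Ω) {c : ℝ}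
    (h : ∀ᵐ w ∂P, (τ.1 w : ℝ) ≤ c) : essSup (fun w => (τ.1 w : ℝ)) P ≤ c :=
  essSup_le_of_ae_le c h ⟨0, fun a ha => by
    obtain ⟨w, hw⟩ := (Filter.eventually_map.1 ha).exists
    exact (τ.1 w).2.1.trans hw⟩

lemma le_essInf_randomTime [NeZero P] (τ : RandomTime Ω) {c : ℝ}
    (h : ∀ᵐ w ∂P, c ≤ (τ.1 w : ℝ)) : c ≤ essInf (fun w => (τ.1 w : ℝ)) P :=
  le_essInf_of_ae_le c h ⟨1, fun a ha => by
    obtain ⟨w, hw⟩ := (Filter.eventually_map.1 ha).exists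
    exact le_trans hw (τ.1 w).2.2⟩

lemma measure_near_essSup_ne_zero [NeZero P] (τ : RandomTime Ω) {ε : ℝ} (hε : 0 < ε) :
    P {w | |(τ.1 w : ℝ) - essSup (fun w => (τ.1 w : ℝ)) P| ≤ ε} ≠ 0 := by
  intro h0
  have h1 := measure_eq_zero_iff_ae_notMem.1 h0
  have h2 := essSup_randomTime_le τ (c := essSup (fun w => (τ.1 w : ℝ)) P - ε) (by
    filter_upwards [h1, ae_le_essSup_randomTime (P := P) τ] with w hw hw'
    by_contra! hlt
    exact hw (abs_le.2 ⟨by linarith, by linarith⟩))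
  linarith

lemma measure_near_essInf_ne_zero [NeZero P] (τ : RandomTime Ω) {ε : ℝ} (hε : 0 < ε) :
    P {w | |(τ.1 w : ℝ) - essInf (fun w => (τ.1 w : ℝ)) P| ≤ ε} ≠ 0 := by
  intro h0
  have h1 := measure_eq_zero_iff_ae_notMem.1 h0
  have h2 := le_essInf_randomTime τ (c := essInf (fun w => (τ.1 w : ℝ)) P + ε) (by
    filter_upwards [h1, ae_essInf_le_randomTime (P := P) τ] with w hw hw'
    by_contra! hlt
    exact hw (abs_le.2 ⟨by linarith, by linarith⟩))
  linarith

end EssentialRange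

/-! ### Matching the two bounds. -/

section Optimum

variable {Ω : Type*} [MeasurableSpace Ω] {P : Measure Ω} {ω : ℝ → ℝ}

lemma isOptimum_of_le {n : ℕ} [NeZero n] {τ : RandomTime Ω} {v : ℝ} {t : Fin n → ℝ}
    (ht : t ∈ admissibleDelays P τ n) (hup : delayError P ω τ t ≤ ENNReal.ofReal v)
    (hlow : ∀ s ∈ admissibleDelays P τ n, ENNReal.ofReal v ≤ delayError P ω τ s) :
    IsOptimum P ω τ n v t :=
  ⟨le_antisymm ((iInf₂_le t ht).trans hup) (le_iInf₂ hlow), ht, le_antisymm hup (hlow t ht)⟩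

/-- Positivity of h is needed only for strict monotonicity, which is vacuous for a single node;
there h = 0 can occur. -/
lemma mul_mem_admissibleDelays {N : ℕ} [NeZero (N + 1)] {τ : RandomTime Ω} {h B : ℝ}
    (hh : 0 ≤ h) (hN : N ≠ 0 → 0 < h) (hB : ∀ᵐ w ∂P, (τ.1 w : ℝ) ≤ B)
    (hNB : 2 * N * h + B ≤ 1) :
    (fun k : Fin (N + 1) => 2 * ((k : ℕ) : ℝ) * h) ∈ admissibleDelays P τ (N + 1) := by
  refine ⟨by simp, fun i j hij => ?_, fun k => hB.mono fun w hw => ?_⟩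
  · have hij' : (i : ℕ) < j := hij
    have h1 : ((i : ℕ) : ℝ) < ((j : ℕ) : ℝ) := by exact_mod_cast hij'
    have := hN (by have := j.2; omega)
    simp only
    nlinarith
  · have h1 : ((k : ℕ) : ℝ) ≤ N := by exact_mod_cast Nat.lt_succ_iff.1 k.2
    nlinarith

/-- The optimum is found by matching the uniform upper bound with a tangent lower bound. -/
lemma isOptimum_mul [IsProbabilityMeasure P] (hω : IsConcaveModulus ω) {N : ℕ}
    [NeZero (N + 1)] {τ : RandomTime Ω} {h A B : ℝ} (hh : 0 ≤ h) (hN : N ≠ 0 → 0 < h)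
    (hA : 0 ≤ A) (hAB : A ≤ B) (hsum : 2 * N * h + A + B = 1)
    (hτA : ∀ᵐ w ∂P, A ≤ τ.1 w) (hτB : ∀ᵐ w ∂P, (τ.1 w : ℝ) ≤ B)
    (hlow : ∀ t ∈ admissibleDelays P τ (N + 1), ∃ s r : ℝ, 0 ≤ s ∧ 0 ≤ r ∧
      s + t (Fin.last N) ≤ 1 ∧ (∀ ε > 0, P {w | |(τ.1 w : ℝ) - s| ≤ ε} ≠ 0) ∧
      modulusIntegral ω A + modulusIntegral ω B ≤ modulusIntegral ω s + modulusIntegral ω r +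
        (ω h * (t (Fin.last N) - 2 * N * h) + ω r * (1 - s - t (Fin.last N) - r))) :
    IsOptimum P ω τ (N + 1)
      (2 * N * modulusIntegral ω h + modulusIntegral ω A + modulusIntegral ω B)
      (fun k => 2 * ((k : ℕ) : ℝ) * h) := by
  refine isOptimum_of_le (mul_mem_admissibleDelays hh hN hτB (by linarith))
    (delayError_le hω hh hA hAB hsum hτA hτB) fun t ht => ?_
  obtain ⟨s, r, hs0, hr0, hs1, hs, hle⟩ := hlow t ht
  refine le_trans (ENNReal.ofReal_le_ofReal ?_)
    (tangent_le_delayError hω ht hs hs0 hs1 hh hr0)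
  linarith

end Optimum

end OptimalRecovery

/-! ### The three regimes. -/

theorem theorem3 {Ω : Type*} [MeasurableSpace Ω] (P : Measure Ω) [IsProbabilityMeasure P]
    (ω : ℝ → ℝ) (hω : OptimalRecovery.IsConcaveModulus ω)
    (n : ℕ) [NeZero n] (τ : OptimalRecovery.RandomTime Ω)
    (m M : ℝ) (hm : m = essInf (fun w => (τ.1 w : ℝ)) P)
    (hM : M = essSup (fun w => (τ.1 w : ℝ)) P)
    (hadm : (OptimalRecovery.admissibleDelays P τ n).Nonempty) :
    ((2 * (n : ℝ) - 1) * m + M ≥ 1 →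
      OptimalRecovery.IsOptimum P ω τ n
        ((2 * (n : ℝ) - 1) * OptimalRecovery.modulusIntegral ω ((1 - M) / (2 * (n : ℝ) - 1)) +
          OptimalRecovery.modulusIntegral ω M)
        (fun k => 2 * ((k : ℕ) : ℝ) * (1 - M) / (2 * (n : ℝ) - 1))) ∧
    ((2 * (n : ℝ) - 1) * M + m ≤ 1 →
      OptimalRecovery.IsOptimum P ω τ n
        ((2 * (n : ℝ) - 1) * OptimalRecovery.modulusIntegral ω ((1 - m) / (2 * (n : ℝ) - 1)) +
          OptimalRecovery.modulusIntegral ω m)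
        (fun k => 2 * ((k : ℕ) : ℝ) * (1 - m) / (2 * (n : ℝ) - 1))) ∧
    (¬ ((2 * (n : ℝ) - 1) * m + M ≥ 1) → ¬ ((2 * (n : ℝ) - 1) * M + m ≤ 1) →
      OptimalRecovery.IsOptimum P ω τ n
        ((2 * (n : ℝ) - 2) * OptimalRecovery.modulusIntegral ω ((1 - m - M) / (2 * (n : ℝ) - 2)) +
          OptimalRecovery.modulusIntegral ω m + OptimalRecovery.modulusIntegral ω M)
        (fun k => ((k : ℕ) : ℝ) * (1 - m - M) / ((n : ℝ) - 1))) := by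
  obtain ⟨N, rfl⟩ := Nat.exists_eq_succ_of_ne_zero (NeZero.ne n)
  rw [Nat.succ_eq_add_one] at *
  have hτm : ∀ᵐ w ∂P, m ≤ τ.1 w := hm ▸ OptimalRecovery.ae_essInf_le_randomTime τ
  have hτM : ∀ᵐ w ∂P, (τ.1 w : ℝ) ≤ M := hM ▸ OptimalRecovery.ae_le_essSup_randomTime τ
  have hnm : ∀ ε > 0, P {w | |(τ.1 w : ℝ) - m| ≤ ε} ≠ 0 := fun ε hε =>
    hm ▸ OptimalRecovery.measure_near_essInf_ne_zero τ hε
  have hnM : ∀ ε > 0, P {w | |(τ.1 w : ℝ) - M| ≤ ε} ≠ 0 := fun ε hε =>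
    hM ▸ OptimalRecovery.measure_near_essSup_ne_zero τ hε
  have hm0 : 0 ≤ m := hm ▸ OptimalRecovery.le_essInf_randomTime τ
    (.of_forall fun w => (τ.1 w).2.1)
  have hM1 : M ≤ 1 := hM ▸ OptimalRecovery.essSup_randomTime_le τ
    (.of_forall fun w => (τ.1 w).2.2)
  have hmM : m ≤ M := by
    obtain ⟨w, h1, h2⟩ := (hτm.and hτM).exists
    exact h1.trans h2
  have hM0 : 0 ≤ M := hm0.trans hmM
  have hlast : ∀ t ∈ OptimalRecovery.admissibleDelays P τ (N + 1), M + t (Fin.last N) ≤ 1 := by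
    intro t ht
    have := OptimalRecovery.essSup_randomTime_le (P := P) τ (c := 1 - t (Fin.last N))
      ((ht.2.2 (Fin.last N)).mono fun w hw => by linarith)
    rw [← hM] at this
    linarith
  have hMlt : N ≠ 0 → M < 1 := by
    intro hN
    obtain ⟨t, ht⟩ := hadm
    have h1 := hlast t ht
    have h2 : t 0 < t (Fin.last N) := ht.2.1 (by
      rw [Fin.lt_def]; simpa using Nat.pos_of_ne_zero hN)
    have h3 : t 0 = 0 := ht.1
    linarith
  have hNr : (0 : ℝ) ≤ N := Nat.cast_nonneg N
  have hd : (0 : ℝ) < 2 * ((N + 1 : ℕ) : ℝ) - 1 := by push_cast; linarith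
  have hd' : 2 * ((N + 1 : ℕ) : ℝ) - 1 = 2 * N + 1 := by push_cast; ring
  refine ⟨fun hcase => ?_, fun hcase => ?_, fun hcase₁ hcase₂ => ?_⟩
  · obtain ⟨h, hh⟩ : ∃ h, h = (1 - M) / (2 * ((N + 1 : ℕ) : ℝ) - 1) := ⟨_, rfl⟩
    have hmul : (2 * N + 1) * h = 1 - M := by rw [hh, hd']; field_simp
    have hh0 : 0 ≤ h := hh ▸ div_nonneg (by linarith) hd.le
    have hhm : h ≤ m := by
      rw [hh, div_le_iff₀ hd]; linarith
    -- A = h, B = M: the bound h ≤ m ≤ τ suffices, and makes the short end as costly as a half-cell.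
    have key := OptimalRecovery.isOptimum_mul (P := P) (N := N) (τ := τ) hω hh0
      (fun hN => hh ▸ div_pos (by linarith [hMlt hN]) hd) hh0 (hhm.trans hmM) (by linarith)
      (hτm.mono fun w hw => hhm.trans hw) hτM fun t ht =>
        ⟨M, h, hM0, hh0, hlast t ht, hnM, by
          -- Both tangents are taken at h, so their linear terms cancel whatever tₙ is.
          have : t (Fin.last N) - 2 * N * h + (1 - M - t (Fin.last N) - h) = 0 := by linarith
          rw [← mul_add, this]; linarith⟩
    convert key using 1
    · rw [← hh, hd']; ring
    · ext k; rw [hh, mul_div_assoc]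
  · obtain ⟨h, hh⟩ : ∃ h, h = (1 - m) / (2 * ((N + 1 : ℕ) : ℝ) - 1) := ⟨_, rfl⟩
    have hmul : (2 * N + 1) * h = 1 - m := by rw [hh, hd']; field_simp
    have hh0 : 0 ≤ h := hh ▸ div_nonneg (by linarith) hd.le
    have hMh : M ≤ h := by
      rw [hh, le_div_iff₀ hd]; linarith
    -- A = m, B = h: here the long end is the one made equal to a half-cell.
    have key := OptimalRecovery.isOptimum_mul (P := P) (N := N) (τ := τ) hω hh0
      (fun hN => hh ▸ div_pos (by linarith [hMlt hN]) hd) hm0 (hmM.trans hMh) (by linarith)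
      hτm (hτM.mono fun w hw => hw.trans hMh) fun t ht =>
        ⟨m, h, hm0, hh0, by linarith [hlast t ht], hnm, by
          have : t (Fin.last N) - 2 * N * h + (1 - m - t (Fin.last N) - h) = 0 := by linarith
          rw [← mul_add, this]; linarith⟩
    convert key using 1
    · rw [← hh, hd']; ring
    · ext k; rw [hh, mul_div_assoc]
  · rw [hd'] at hcase₁ hcase₂
    push Not at hcase₁ hcase₂
    -- For a single node the negated conditions read m + M < 1 and m + M > 1.
    have hN : N ≠ 0 := by
      rintro rfl
      push_cast at hcase₁ hcase₂
      linarith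
    have hNpos : (0 : ℝ) < N := by exact_mod_cast Nat.pos_of_ne_zero hN
    have hd2 : 2 * ((N + 1 : ℕ) : ℝ) - 2 = 2 * N := by push_cast; ring
    obtain ⟨h, hh⟩ : ∃ h, h = (1 - m - M) / (2 * ((N + 1 : ℕ) : ℝ) - 2) := ⟨_, rfl⟩
    have hmul : 2 * N * h = 1 - m - M := by rw [hh, hd2]; field_simp
    have hmh : m ≤ h := by
      rw [hh, hd2, le_div_iff₀ (by positivity)]; linarith
    have hhM : h ≤ M := by
      rw [hh, hd2, div_le_iff₀ (by positivity)]; linarith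
    have hmlt : 0 < h := by
      rw [hh, hd2]
      refine div_pos ?_ (by positivity)
      nlinarith
    have key := OptimalRecovery.isOptimum_mul (P := P) (N := N) (τ := τ) hω hmlt.le
      (fun _ => hmlt) hm0 hmM (by linarith) hτm hτM fun t ht => by
        -- The leftover linear term is (ω h - ω r)(tₙ - (1 - m - M)). Since m ≤ h ≤ M, it is
        -- non-negative with r = m (so s = M) when tₙ is large, and with r = M (so s = m) when tₙ is
        -- small.
        rcases le_total (1 - m - M) (t (Fin.last N)) with hT | hT
        · refine ⟨M, m, hM0, hm0, hlast t ht, hnM, ?_⟩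
          have := mul_nonneg (sub_nonneg.2 (hω.mono hm0 hmh)) (sub_nonneg.2 hT)
          rw [hmul]
          linarith
        · refine ⟨m, M, hm0, hM0, by linarith [hlast t ht], hnm, ?_⟩
          have := mul_nonneg (sub_nonneg.2 (hω.mono hmlt.le hhM)) (sub_nonneg.2 hT)
          rw [hmul]
          linarith
    convert key using 1
    · rw [← hh, hd2]
    · ext k
      rw [hh]
      push_cast
      field_simp
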